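/- Fix $p\in(0,1)$. Let $f(d,x,y)$ be a real function of $d\in\{0,1,2,\dots,\infty\}$ and $x,y\in\mathbb R$, symmetric in $x$ and $y$. For a simple graph $G$ on $n$ vertices with degrees $d_i$ and distances $D(i,j)$ (with $D(i,j)=\infty$ if $i,j$ lie in different components), let $W_f(G)$ be the $n\times n$ matrix with entries $f(D(i,j),d_i,d_j)$ for $i\ne j$ and $0$ for $i=j$, let $D_f(G)$ be the diagonal matrix of the row sums of $W_f(G)$, and put $L_f(G)=D_f(G)-W_f(G)$ and $L_f^+(G)=D_f(G)+W_f(G)$. The weighted Laplacian-energy like invariant and the weighted incidence energy are $$\mathscr{LEL}_f(G)=\sum_{i=1}^n\sqrt{|\lambda_i(L_f(G))|},\qquad \mathscr{IE}_f(G)=\sum_{i=1}^n\sqrt{|\lambda_i(L_f^+(G))|},$$ where $\lambda_1,\dots,\lambda_n$ are the eigenvalues with multiplicity. Assume that for $d=1,2$ $$f(d,(1+o(1))np,(1+o(1))np)=(1+o(1))f(d,np,np)\qquad(n\to\infty),$$ that is, for all real sequences $x_n,y_n$ with $x_n/(np)\to1$ and $y_n/(np)\to1$ one has $f(d,x_n,y_n)=(1+o(1))f(d,np,np)$.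 Let $G_p\in\mathcal G_{n,p}$ be the random graph on $n$ labelled vertices in which each edge is present independently with probability $p$. "For almost all $G_p$, $X(G_p)=a_n(c+o(1))n^{3/2}$" means that for every $\varepsilon>0$, with probability tending to $1$ as $n\to\infty$, $X(G_p)=a_n(c+\eta)n^{3/2}$ for some $\eta$ with $|\eta|\le\varepsilon$. (i) If $f(1,np,np)/f(2,np,np)\to\pm\infty$, meaning $|f(1,np,np)/f(2,np,np)|\to\infty$ with the convention $|a/0|=\infty$ for $a\neq0$ and $|0/0|=0$, then for almost all $G_p$ $$\mathscr{LEL}_f(G_p)=\sqrt{|f(1,np,np)|}\,(\sqrt p+o(1))\,n^{3/2},\qquad \mathscr{IE}_f(G_p)=\sqrt{|f(1,np,np)|}\,(\sqrt p+o(1))\,n^{3/2}.$$ (ii) If $f(2,np,np)\neq0$ for all large $n$ and $f(1,np,np)/f(2,np,np)\to C\in\mathbb R$, then for almost all $G_p$ $$\mathscr{LEL}_f(G_p)=\sqrt{|f(2,np,np)|}\,\bigl(\sqrt{|1+(C-1)p|}+o(1)\bigr)\,n^{3/2},\qquad \mathscr{IE}_f(G_p)=\sqrt{|f(2,np,np)|}\,\bigl(\sqrt{|1+(C-1)p|}+o(1)\bigr)\,n^{3/2}.$$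 -/

import Mathlib

open Filter Topology

/-- The weighted distance matrix `W_f(G)`: its entries off the diagonal are `f (D(i, j), dᵢ, dⱼ)`,
and its diagonal entries are `0`. The distance takes values in `ℕ∞`; it is `⊤` for two vertices in
different components. -/
noncomputable def weightedDistanceMatrix {V : Type*} [Fintype V] [DecidableEq V]
    (f : ℕ∞ → ℝ → ℝ → ℝ) (G : SimpleGraph V) : Matrix V V ℝ :=
  open Classical in
  Matrix.of fun i j => if i = j then 0 else f (G.edist i j) (G.degree i) (G.degree j)

/-- The diagonal matrix `D_f(G)` of the row sums of `W_f(G)`. -/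
noncomputable def weightedDegreeMatrix {V : Type*} [Fintype V] [DecidableEq V]
    (f : ℕ∞ → ℝ → ℝ → ℝ) (G : SimpleGraph V) : Matrix V V ℝ :=
  Matrix.diagonal fun i => ∑ j, weightedDistanceMatrix f G i j

/-- The weighted Laplacian matrix `L_f(G) = D_f(G) - W_f(G)`. -/
noncomputable def weightedLaplacian {V : Type*} [Fintype V] [DecidableEq V]
    (f : ℕ∞ → ℝ → ℝ → ℝ) (G : SimpleGraph V) : Matrix V V ℝ :=
  weightedDegreeMatrix f G - weightedDistanceMatrix f G

/-- The weighted signless Laplacian matrix `L_f⁺(G) = D_f(G) + W_f(G)`. -/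
noncomputable def weightedSignlessLaplacian {V : Type*} [Fintype V] [DecidableEq V]
    (f : ℕ∞ → ℝ → ℝ → ℝ) (G : SimpleGraph V) : Matrix V V ℝ :=
  weightedDegreeMatrix f G + weightedDistanceMatrix f G

theorem weightedDistanceMatrix_isHermitian {V : Type*} [Fintype V] [DecidableEq V]
    {f : ℕ∞ → ℝ → ℝ → ℝ} (hf : ∀ d x y, f d x y = f d y x) (G : SimpleGraph V) :
    (weightedDistanceMatrix f G).IsHermitian := by
  classical
  refine Matrix.IsHermitian.ext fun i j => ?_
  simp only [weightedDistanceMatrix, Matrix.of_apply, star_trivial]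
  rw [SimpleGraph.edist_comm, hf]
  simp only [eq_comm]

theorem weightedDegreeMatrix_isHermitian {V : Type*} [Fintype V] [DecidableEq V]
    (f : ℕ∞ → ℝ → ℝ → ℝ) (G : SimpleGraph V) :
    (weightedDegreeMatrix f G).IsHermitian :=
  Matrix.isHermitian_diagonal _

theorem weightedLaplacian_isHermitian {V : Type*} [Fintype V] [DecidableEq V]
    {f : ℕ∞ → ℝ → ℝ → ℝ} (hf : ∀ d x y, f d x y = f d y x) (G : SimpleGraph V) :
    (weightedLaplacian f G).IsHermitian :=
  (weightedDegreeMatrix_isHermitian f G).sub (weightedDistanceMatrix_isHermitian hf G)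

theorem weightedSignlessLaplacian_isHermitian {V : Type*} [Fintype V] [DecidableEq V]
    {f : ℕ∞ → ℝ → ℝ → ℝ} (hf : ∀ d x y, f d x y = f d y x) (G : SimpleGraph V) :
    (weightedSignlessLaplacian f G).IsHermitian :=
  (weightedDegreeMatrix_isHermitian f G).add (weightedDistanceMatrix_isHermitian hf G)

/-- The weighted Laplacian-energy like invariant: the sum of `√|λ|` over the eigenvalues `λ` of
`L_f(G)`, with multiplicity. -/
noncomputable def weightedLEL {V : Type*} [Fintype V] [DecidableEq V]
    (f : ℕ∞ → ℝ → ℝ → ℝ) (hf : ∀ d x y, f d x y = f d y x) (G : SimpleGraph V) : ℝ :=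
  ∑ i, √|(weightedLaplacian_isHermitian hf G).eigenvalues i|

/-- The weighted incidence energy: the sum of `√|λ|` over the eigenvalues `λ` of `L_f⁺(G)`, with
multiplicity. -/
noncomputable def weightedIE {V : Type*} [Fintype V] [DecidableEq V]
    (f : ℕ∞ → ℝ → ℝ → ℝ) (hf : ∀ d x y, f d x y = f d y x) (G : SimpleGraph V) : ℝ :=
  ∑ i, √|(weightedSignlessLaplacian_isHermitian hf G).eigenvalues i|

/-- `g ((1 + o(1)) n p, (1 + o(1)) n p) = (1 + o(1)) g (n p, n p)` as `n → ∞`. -/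
def StableNearMean (g : ℝ → ℝ → ℝ) (p : ℝ) : Prop :=
  ∀ x y : ℕ → ℝ,
    Asymptotics.IsEquivalent atTop x (fun n => (n : ℝ) * p) →
    Asymptotics.IsEquivalent atTop y (fun n => (n : ℝ) * p) →
    Asymptotics.IsEquivalent atTop (fun n => g (x n) (y n))
      (fun n => g ((n : ℝ) * p) ((n : ℝ) * p))

/-- Almost all graphs in the binomial random graph model on `n` vertices with edge probability `p`
have the property `P n`: the probability of `P n` tends to `1` as `n → ∞`. -/
def AlmostAll (p : unitInterval) (P : ∀ n : ℕ, SimpleGraph (Fin n) → Prop) : Prop :=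
  Tendsto (fun n : ℕ => SimpleGraph.binomialRandom (Fin n) p {G | P n G}) atTop (𝓝 1)

/-- For almost all graphs, `X n G = a n * (c + o(1)) * n ^ (3 / 2)`: however small `ε > 0` is, for
almost all graphs the term written `o(1)` is at most `ε` in absolute value. -/
def AlmostAllAsymp (p : unitInterval) (X : ∀ n : ℕ, SimpleGraph (Fin n) → ℝ)
    (a : ℕ → ℝ) (c : ℝ) : Prop :=
  ∀ ε : ℝ, 0 < ε → AlmostAll p fun n G =>
    ∃ η : ℝ, |η| ≤ ε ∧ X n G = a n * (c + η) * (n : ℝ) ^ (3 / 2 : ℝ)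

/-! No eigenvalue distribution is needed, because the diagonal dominates. In a typical graph all
degrees are close to `n p` and nonadjacent vertices are at distance 2. With weights asymptotic to `A
g` and `B g`, every row sum is then `c = n (p A + (1 - p) B) g` up to `o(n |g|)`, while off-diagonal
entries are only `O(|g|)`. Hence `∑ (λ - c) ^ 2`, the squared Frobenius norm of `M - c I`, is `n ·
o(n² g²) + n² · O(g²) = o(n³ g²)`. Since `|√|λ| - √|c|| ≤ √|λ - c|`, two applications of
Cauchy–Schwarz bound `|∑ √|λ| - n √|c||` by `(n³ ∑ (λ - c) ^ 2) ^ (1/4) = o(√|g| n ^ (3/2))`, even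
when `c = 0`. The sign of `W_f` plays no role, so both invariants have the same limit. The main
inputs are `abs_sum_sqrt_abs_eigenvalues_sub_le`, `almostAll_isTypical` and the uniformity of the
weights in `StableNearMean.exists_eventually_abs_sub_le`. -/

theorem abs_sqrt_abs_sub_sqrt_abs_le (x y : ℝ) : |√|x| - √(|y|)| ≤ √|x - y| := by
  wlog h : |y| ≤ |x| generalizing x y
  · rw [abs_sub_comm, abs_sub_comm x y]
    exact this y x (le_of_not_ge h)
  rw [abs_of_nonneg (sub_nonneg.2 (Real.sqrt_le_sqrt h)), sub_le_iff_le_add]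
  calc √|x| ≤ √(|x - y| + |y|) := Real.sqrt_le_sqrt (by
        have := abs_add_le (x - y) y
        rwa [sub_add_cancel] at this)
    _ ≤ √|x - y| + √|y| := by
        rw [Real.sqrt_le_left (by positivity), add_sq, Real.sq_sqrt (abs_nonneg _),
          Real.sq_sqrt (abs_nonneg _)]
        have : 0 ≤ 2 * √|x - y| * √|y| := by positivity
        linarith

/-! ### Eigenvalue sums and Frobenius distance to a scalar matrix. -/

namespace Matrix.IsHermitian

variable {V : Type*} [Fintype V] [DecidableEq V]

/-- Both sides are the trace of `(M - c I) ^ 2`, computed in an eigenbasis and in the standard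
basis. -/
theorem sum_sq_eigenvalues_sub {M : Matrix V V ℝ} (hM : M.IsHermitian) (c : ℝ) :
    ∑ i, (hM.eigenvalues i - c) ^ 2 = ∑ i, ∑ j, (M i j - if i = j then c else 0) ^ 2 := by
  have key : (M - c • (1 : Matrix V V ℝ)) * (M - c • (1 : Matrix V V ℝ)) =
      Unitary.conjStarAlgAut ℝ _ hM.eigenvectorUnitary
        (diagonal fun i => (hM.eigenvalues i - c) ^ 2) := by
    have h : M - c • (1 : Matrix V V ℝ) = Unitary.conjStarAlgAut ℝ _ hM.eigenvectorUnitary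
        (diagonal fun i => hM.eigenvalues i - c) := by
      have hd : (diagonal fun i => hM.eigenvalues i - c) =
          diagonal (RCLike.ofReal ∘ hM.eigenvalues) - c • (1 : Matrix V V ℝ) := by
        ext i j
        by_cases hij : i = j <;> simp [hij]
      rw [hd, map_sub, ← hM.spectral_theorem, map_smul, map_one]
    rw [h, ← map_mul, diagonal_mul_diagonal]
    simp only [pow_two]
  have htr := congrArg trace key
  rw [Unitary.conjStarAlgAut_apply, trace_mul_cycle, Unitary.coe_star_mul_self, one_mul,
    trace_diagonal] at htr
  rw [← htr, trace]
  refine Finset.sum_congr rfl fun i _ => ?_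
  rw [diag_apply, mul_apply]
  refine Finset.sum_congr rfl fun j _ => ?_
  have hs : M j i = M i j := by simpa using hM.apply i j
  by_cases hij : i = j
  · simp [hij, pow_two]
  · simp [hij, Ne.symm hij, pow_two, hs]

/-- Cauchy–Schwarz is applied to `√|λ - c|` and again to `|λ - c|`. The resulting fourth root turns
`r ^ 4` into the relative error `r` and the scale `s ^ 2` into `√s`. -/
theorem abs_sum_sqrt_abs_eigenvalues_sub_le {M : Matrix V V ℝ} (hM : M.IsHermitian)
    {c r s : ℝ} (hr : 0 ≤ r) (hs : 0 ≤ s)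
    (h : ∑ i, ∑ j, (M i j - if i = j then c else 0) ^ 2 ≤ r ^ 4 * Fintype.card V * s ^ 2) :
    |∑ i, √|hM.eigenvalues i| - Fintype.card V * √(|c|)| ≤ r * Fintype.card V * √s := by
  set x : V → ℝ := fun i => hM.eigenvalues i - c
  set N := (Fintype.card V : ℝ)
  have hN : 0 ≤ N := Nat.cast_nonneg _
  have h1 : |∑ i, √|hM.eigenvalues i| - N * √(|c|)| ≤ ∑ i, √|x i| := by
    have : ∑ i, √|hM.eigenvalues i| - N * √|c| = ∑ i, (√|hM.eigenvalues i| - √|c|) := by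
      simp [Finset.sum_sub_distrib, N]
    rw [this]
    exact (Finset.abs_sum_le_sum_abs _ _).trans
      (Finset.sum_le_sum fun i _ => abs_sqrt_abs_sub_sqrt_abs_le _ _)
  refine h1.trans ?_
  have h2 : (∑ i, √|x i|) ^ 2 ≤ N * ∑ i, |x i| := by
    have := sq_sum_le_card_mul_sum_sq (s := Finset.univ) (f := fun i => √|x i|)
    simpa [N] using this
  have h3 : (∑ i, |x i|) ^ 2 ≤ N * ∑ i, x i ^ 2 := by
    have := sq_sum_le_card_mul_sum_sq (s := Finset.univ) (f := fun i => |x i|)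
    simpa [N] using this
  have h4 : ∑ i, x i ^ 2 ≤ r ^ 4 * N * s ^ 2 := (hM.sum_sq_eigenvalues_sub c).trans_le h
  refine le_of_pow_le_pow_left₀ (n := 4) (by norm_num) (by positivity) ?_
  have hs4 : √s ^ 4 = s ^ 2 := by
    rw [show 4 = 2 * 2 by norm_num, pow_mul, Real.sq_sqrt hs]
  calc (∑ i, √|x i|) ^ 4 = ((∑ i, √|x i|) ^ 2) ^ 2 := by ring
    _ ≤ (N * ∑ i, |x i|) ^ 2 := by gcongr
    _ = N ^ 2 * (∑ i, |x i|) ^ 2 := by ring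
    _ ≤ N ^ 2 * (N * (r ^ 4 * N * s ^ 2)) := by gcongr; exact h3.trans (by gcongr)
    _ = (r * N * √s) ^ 4 := by rw [mul_pow, hs4]; ring

end Matrix.IsHermitian

/-! ### Typical graphs and uniform control of the weights. -/

/-- The degrees of `G` differ from `n p` by at most `δ n`, and any two vertices have a common
neighbour. -/
def SimpleGraph.IsTypical {V : Type*} [Fintype V] (p δ : ℝ) (G : SimpleGraph V) : Prop :=
  open Classical in
  (∀ i, |(G.degree i : ℝ) - Fintype.card V * p| ≤ δ * Fintype.card V) ∧
    ∀ i j, i ≠ j → ∃ k, G.Adj i k ∧ G.Adj j k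

theorem SimpleGraph.edist_eq_two_of_common_neighbor {V : Type*} {G : SimpleGraph V} {i j k : V}
    (hij : i ≠ j) (hadj : ¬ G.Adj i j) (hi : G.Adj i k) (hj : G.Adj j k) : G.edist i j = 2 := by
  have hle : G.edist i j ≤ 2 := by
    simpa using (Walk.cons hi (Walk.cons hj.symm Walk.nil)).edist_le
  lift G.edist i j to ℕ using (ne_top_of_le_ne_top (by decide) hle) with d hd
  have h0 : d ≠ 0 := by
    rintro rfl
    exact hij (SimpleGraph.edist_eq_zero_iff.1 hd.symm)
  have h1 : d ≠ 1 := by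
    rintro rfl
    exact hadj (SimpleGraph.edist_eq_one_iff_adj.1 hd.symm)
  have h2 : d ≤ 2 := by exact_mod_cast hle
  have : d = 2 := by omega
  simp [this]

/-- Near the mean, the values of a stable function relative to a comparison sequence converge
uniformly. -/
theorem StableNearMean.exists_eventually_abs_sub_le {φ : ℝ → ℝ → ℝ} {p : ℝ} (hp : 0 < p)
    (hφ : StableNearMean φ p) {g : ℕ → ℝ} (hg : ∀ᶠ n in atTop, g n ≠ 0) {A : ℝ}
    (hA : Tendsto (fun n : ℕ => φ (n * p) (n * p) / g n) atTop (𝓝 A)) {τ : ℝ} (hτ : 0 < τ) :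
    ∃ δ > 0, ∀ᶠ n : ℕ in atTop, ∀ x y : ℝ, |x - n * p| ≤ δ * n → |y - n * p| ≤ δ * n →
      |φ x y - A * g n| ≤ τ * |g n| := by
  -- If every `δ = 1 / (k + 1)` fails, bad points exist along a subsequence `ψ` and approach the
  -- mean.
  by_contra! hcon
  have hfreq : ∀ k : ℕ, ∃ᶠ n : ℕ in atTop, ∃ x y : ℝ, |x - n * p| ≤ 1 / ((k : ℝ) + 1) * n ∧
      |y - n * p| ≤ 1 / ((k : ℝ) + 1) * n ∧ τ * |g n| < |φ x y - A * g n| := by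
    intro k
    have := hcon (1 / ((k : ℝ) + 1)) (by positivity)
    simpa using this
  obtain ⟨ψ, hψ, hbad⟩ := extraction_forall_of_frequently hfreq
  choose x y hx hy hxy using hbad
  -- Stability concerns full sequences, so the bad points are extended off the range of `ψ` by the
  -- mean `n p` itself.
  have hequiv : ∀ z : ℕ → ℝ, (∀ k, |z k - ψ k * p| ≤ 1 / ((k : ℝ) + 1) * ψ k) →
      Asymptotics.IsEquivalent atTop (Function.extend ψ z fun n => (n : ℝ) * p)
        (fun n : ℕ => (n : ℝ) * p) := by
    intro z hz
    rw [Asymptotics.IsEquivalent, Asymptotics.isLittleO_iff]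
    intro c hc
    obtain ⟨K, hK⟩ := exists_nat_one_div_lt (mul_pos hc hp)
    filter_upwards [eventually_ge_atTop (ψ K)] with n hn
    by_cases hnψ : ∃ k, ψ k = n
    · obtain ⟨k, rfl⟩ := hnψ
      have hKk : K ≤ k := hψ.le_iff_le.1 hn
      simp only [Pi.sub_apply, hψ.injective.extend_apply, Real.norm_eq_abs]
      refine (hz k).trans ?_
      rw [abs_of_nonneg (by positivity : (0 : ℝ) ≤ ψ k * p)]
      have : 1 / ((k : ℝ) + 1) ≤ c * p := by
        refine le_trans ?_ hK.le
        gcongr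
      calc 1 / ((k : ℝ) + 1) * ψ k ≤ c * p * ψ k := by gcongr
        _ = c * (ψ k * p) := by ring
    · simp only [Pi.sub_apply, Function.extend_apply' _ _ _ hnψ, sub_self, norm_zero]
      positivity
  have hlim : Tendsto (fun n => φ (Function.extend ψ x (fun n => (n : ℝ) * p) n)
      (Function.extend ψ y (fun n => (n : ℝ) * p) n) / g n) atTop (𝓝 A) :=
    ((hφ _ _ (hequiv x hx) (hequiv y hy)).div
      (Asymptotics.IsEquivalent.refl (u := g))).symm.tendsto_nhds hA
  have hclose := (hlim.comp hψ.tendsto_atTop).eventually (Metric.closedBall_mem_nhds A hτ)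
  obtain ⟨k, hk, hgk⟩ := (hclose.and (hψ.tendsto_atTop.eventually hg)).exists
  simp only [Function.comp_apply, hψ.injective.extend_apply,
    Real.dist_eq] at hk
  refine absurd (hxy k) (not_lt.2 ?_)
  have hfac : φ (x k) (y k) - A * g (ψ k) = (φ (x k) (y k) / g (ψ k) - A) * g (ψ k) := by
    field_simp
  rw [hfac, abs_mul]
  gcongr

/-! ### Edge independence and concentration in the binomial random graph. -/

namespace SimpleGraph

open MeasureTheory ProbabilityTheory unitInterval

section Law

variable {V : Type*} (p : I)

theorem measurable_mem_edgeSet (e : Sym2 V) :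
    Measurable fun G : SimpleGraph V => e ∈ G.edgeSet :=
  measurable_set_iff.1 measurable_edgeSet e

variable [Fintype V]

/-- This product form of the joint law yields independence of the edge events. Diagonal pairs are
kept as indices; their factor is a point mass at `False`. -/
theorem map_mem_edgeSet_binomialRandom :
    (binomialRandom V p).map (fun G (e : Sym2 V) => e ∈ G.edgeSet) =
      Measure.infinitePi fun e : Sym2 V =>
        toNNReal p • Measure.dirac (e ∈ (Sym2.diagSetᶜ : Set (Sym2 V))) +
          toNNReal (σ p) • Measure.dirac False := by
  have h1 : (binomialRandom V p).map edgeSet = setBernoulli Sym2.diagSetᶜ p := by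
    rw [binomialRandom_eq_map, Measure.map_map measurable_edgeSet measurable_fromEdgeSet]
    conv_rhs => rw [← Measure.map_id (μ := setBernoulli _ p)]
    refine Measure.map_congr ?_
    -- The random set almost surely contains no diagonal pair, so passing through a simple graph
    -- loses nothing.
    filter_upwards [setBernoulli_ae_subset] with S hS
    simpa [Set.subset_compl_iff_disjoint_right, sdiff_eq_left] using hS
  have h2 : Measurable fun (s : Set (Sym2 V)) (e : Sym2 V) => e ∈ s := by fun_prop
  rw [show (fun (G : SimpleGraph V) (e : Sym2 V) => e ∈ G.edgeSet) =
    (fun (s : Set (Sym2 V)) (e : Sym2 V) => e ∈ s) ∘ edgeSet from rfl,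
    ← Measure.map_map h2 measurable_edgeSet, h1, setBernoulli_eq_map,
    Measure.map_map h2 (by fun_prop)]
  exact Measure.map_id

theorem map_mem_edgeSet_binomialRandom_apply (e : Sym2 V) :
    (binomialRandom V p).map (fun G => e ∈ G.edgeSet) =
        toNNReal p • Measure.dirac (e ∈ (Sym2.diagSetᶜ : Set (Sym2 V))) +
          toNNReal (σ p) • Measure.dirac False := by
  rw [← Measure.infinitePi_map_eval (fun e : Sym2 V =>
        toNNReal p • Measure.dirac (e ∈ (Sym2.diagSetᶜ : Set (Sym2 V))) +
          toNNReal (σ p) • Measure.dirac False) e, ← map_mem_edgeSet_binomialRandom,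
    Measure.map_map (by fun_prop) (measurable_pi_lambda _ measurable_mem_edgeSet)]
  rfl

theorem iIndepFun_mem_edgeSet :
    iIndepFun (fun (e : Sym2 V) (G : SimpleGraph V) => e ∈ G.edgeSet) (binomialRandom V p) := by
  rw [iIndepFun_iff_map_fun_eq_infinitePi_map measurable_mem_edgeSet,
    map_mem_edgeSet_binomialRandom]
  simp_rw [map_mem_edgeSet_binomialRandom_apply]

theorem binomialRandom_real_mem_edgeSet {e : Sym2 V} (he : ¬ e.IsDiag) :
    (binomialRandom V p).real {G | e ∈ G.edgeSet} = p := by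
  have h := congrArg (fun m => m.real {True}) (map_mem_edgeSet_binomialRandom_apply p e)
  simp only [map_measureReal_apply (measurable_mem_edgeSet e) (MeasurableSet.singleton _)] at h
  have hs : (fun G : SimpleGraph V => e ∈ G.edgeSet) ⁻¹' {True} = {G | e ∈ G.edgeSet} := by
    ext G; simp
  rw [hs] at h
  rw [h, measureReal_def]
  simp [he]

variable [DecidableEq V]

theorem binomialRandom_real_no_common_neighbor {i j : V} (hij : i ≠ j) (T : Finset V)
    (hi : i ∉ T) (hj : j ∉ T) :
    (binomialRandom V p).real {G | ∀ k ∈ T, ¬ (G.Adj i k ∧ G.Adj j k)} =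
      (1 - (p : ℝ) ^ 2) ^ T.card := by
  induction T using Finset.induction_on with
  | empty => simp
  | insert a T ha ih =>
    simp only [Finset.mem_insert, not_or] at hi hj
    -- The condition at `a` and the conditions at `T` involve disjoint sets of edges, hence are
    -- independent; each new vertex contributes a factor `1 - p ^ 2`.
    set S₁ : Finset (Sym2 V) := {s(i, a), s(j, a)}
    set S₂ : Finset (Sym2 V) := T.image (fun k => s(i, k)) ∪ T.image (fun k => s(j, k))
    have hdisj : Disjoint S₁ S₂ := by
      rw [Finset.disjoint_left]
      intro e he₁ he₂
      simp only [S₁, S₂, Finset.mem_insert, Finset.mem_singleton, Finset.mem_union,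
        Finset.mem_image] at he₁ he₂
      grind
    have hind := (iIndepFun_mem_edgeSet p).indepFun_finset S₁ S₂ hdisj measurable_mem_edgeSet
    have h1 := hind.measure_inter_preimage_eq_mul
      {v | ¬ (v ⟨s(i, a), by simp [S₁]⟩ ∧ v ⟨s(j, a), by simp [S₁]⟩)}
      {v | ∀ k (hk : k ∈ T), ¬ (v ⟨s(i, k), by
          simp only [S₂, Finset.mem_union, Finset.mem_image]; exact .inl ⟨k, hk, rfl⟩⟩ ∧
        v ⟨s(j, k), by simp only [S₂, Finset.mem_union, Finset.mem_image]; exact .inr ⟨k, hk, rfl⟩⟩)}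
      .of_discrete .of_discrete
    have hadj := ((iIndepFun_mem_edgeSet (V := V) p).indepFun (i := s(i, a)) (j := s(j, a))
      (by
        rw [Ne, Sym2.eq_iff]
        rintro (⟨h, -⟩ | ⟨h, -⟩)
        exacts [hij h, hi.1 h])).measure_inter_preimage_eq_mul {True} {True} .of_discrete .of_discrete
    have h2 : (binomialRandom V p).real {G | G.Adj i a ∧ G.Adj j a} = (p : ℝ) ^ 2 := by
      rw [pow_two]
      nth_rw 1 [← binomialRandom_real_mem_edgeSet p (e := s(i, a)) (by simpa using hi.1)]
      rw [← binomialRandom_real_mem_edgeSet p (e := s(j, a)) (by simpa using hj.1)]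
      simp only [measureReal_def, ← ENNReal.toReal_mul]
      congr 1
      convert hadj using 3 <;> ext G <;> simp
    have h3 : (binomialRandom V p).real {G | ¬ (G.Adj i a ∧ G.Adj j a)} = 1 - (p : ℝ) ^ 2 := by
      rw [← h2, ← probReal_compl_eq_one_sub]
      · rfl
      · exact (measurable_mem_edgeSet s(i, a)).and (measurable_mem_edgeSet s(j, a)) |>.setOf
    rw [Finset.card_insert_of_notMem ha, pow_succ', ← ih hi.2 hj.2, ← h3]
    simp only [measureReal_def, ← ENNReal.toReal_mul]
    congr 1
    convert h1 using 2
    · ext G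
      simp
    · rfl
    · rfl

/-- Hoeffding's inequality for both tails: the degree is a sum of independent indicators, each
subgaussian with parameter `1/4`. The index `j = i` contributes zero to the mean but is still
counted in the variance proxy, whence `n - 1` on the left and `n` on the right. -/
theorem binomialRandom_real_le_abs_degree_sub (i : V) {ε : ℝ} (hε : 0 ≤ ε) :
    open Classical in
    (binomialRandom V p).real {G | ε ≤ |(G.degree i : ℝ) - (Fintype.card V - 1) * p|} ≤
      2 * Real.exp (-ε ^ 2 / (Fintype.card V / 2)) := by
  classical
  set χ : Prop → ℝ := fun q => if q then 1 else 0
  set Y : Sym2 V → SimpleGraph V → ℝ := fun e G => χ (e ∈ G.edgeSet)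
  set μ := binomialRandom V p
  have hYm : ∀ e, Measurable (Y e) := fun e =>
    (Measurable.of_discrete (f := χ)).comp (measurable_mem_edgeSet e)
  have hYint : ∀ e, ¬ e.IsDiag → ∫ G, Y e G ∂μ = p := by
    intro e he
    have : Y e = Set.indicator {G | e ∈ G.edgeSet} 1 := by
      ext G; simp [Y, χ, Set.indicator_apply]
    rw [this, integral_indicator_one, binomialRandom_real_mem_edgeSet p he]
    exact (measurable_mem_edgeSet e).setOf
  have hYdiag : ∀ G, Y s(i, i) G = 0 := fun G => by simp [Y, χ]
  have hind : iIndepFun (fun (j : V) G => Y s(i, j) G - ∫ H, Y s(i, j) H ∂μ) μ := by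
    have h := (iIndepFun_mem_edgeSet p).comp
      (fun e q => χ q - ∫ H, Y e H ∂μ) fun _ => .of_discrete
    exact h.precomp (g := fun j => s(i, j)) fun a b hab => Sym2.congr_right.1 hab
  have hsub := HasSubgaussianMGF.sum_of_iIndepFun hind (s := Finset.univ)
    (c := fun _ => (‖(1 : ℝ) - 0‖₊ / 2) ^ 2) fun j _ =>
      hasSubgaussianMGF_of_mem_Icc (hYm s(i, j)).aemeasurable (.of_forall fun G => by
        by_cases h : s(i, j) ∈ G.edgeSet <;> simp [Y, χ, h])
  have hsum : ∀ G : SimpleGraph V, ∑ j, (Y s(i, j) G - ∫ H, Y s(i, j) H ∂μ) =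
      (G.degree i : ℝ) - (Fintype.card V - 1) * p := by
    intro G
    rw [Finset.sum_sub_distrib]
    congr 1
    · simp [Y, χ, ← G.card_neighborFinset_eq_degree, neighborFinset_eq_filter]
    · rw [← Finset.add_sum_erase _ _ (Finset.mem_univ i),
        Finset.sum_congr rfl fun j hj => hYint s(i, j) (by
          simpa using (Finset.ne_of_mem_erase hj).symm)]
      have : 1 ≤ Fintype.card V := Fintype.card_pos_iff.2 ⟨i⟩
      simp [hYdiag, Finset.card_erase_of_mem, Nat.cast_sub this]
  simp_rw [hsum] at hsub
  have hc : 2 * ((∑ _j : V, (‖(1 : ℝ) - 0‖₊ / 2) ^ 2 : NNReal) : ℝ) = Fintype.card V / 2 := by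
    simp; ring
  have h1 := hsub.measure_ge_le hε
  have h2 := hsub.neg.measure_ge_le hε
  rw [hc] at h1 h2
  calc _ ≤ μ.real ({G | ε ≤ (G.degree i : ℝ) - (Fintype.card V - 1) * p} ∪
        {G | ε ≤ (-fun G : SimpleGraph V =>
          (G.degree i : ℝ) - (Fintype.card V - 1) * p) G}) := by
        refine measureReal_mono fun G hG => ?_
        simpa [le_abs] using hG
    _ ≤ _ := measureReal_union_le _ _
    _ ≤ _ := by linarith

end Law

/-- Union bound over vertices and over ordered pairs; each pair has `n - 2` candidate common
neighbours. -/
theorem binomialRandom_real_not_isTypical_le (p : I) {δ : ℝ} (hδ : 0 < δ) {n : ℕ}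
    (hn : 2 ≤ δ * n) :
    (binomialRandom (Fin n) p).real {G | ¬ G.IsTypical p δ} ≤
      n * (2 * Real.exp (-(δ ^ 2 / 2) * n)) + n ^ 2 * (1 - (p : ℝ) ^ 2) ^ (n - 2) := by
  classical
  set μ := binomialRandom (Fin n) p
  have hn0 : (0 : ℝ) < n := by
    by_contra! h
    nlinarith
  calc μ.real {G | ¬ G.IsTypical p δ}
      ≤ μ.real ((⋃ i : Fin n, {G | δ * n / 2 ≤
            |(G.degree i : ℝ) - (Fintype.card (Fin n) - 1) * p|}) ∪
          ⋃ q ∈ (Finset.univ : Finset (Fin n)).offDiag,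
            {G | ∀ k ∈ Finset.univ \ {q.1, q.2}, ¬ (G.Adj q.1 k ∧ G.Adj q.2 k)}) := by
        refine measureReal_mono fun G hG => ?_
        by_contra hcon
        simp only [Set.mem_union, Set.mem_iUnion, Set.mem_ofPred_eq, not_or, not_exists, not_le,
          Fintype.card_fin] at hcon
        refine hG ⟨fun i => ?_, fun i j hij => ?_⟩
        -- Moving the centre from `(n - 1) p` to `n p` costs `p ≤ 1 ≤ δ n / 2`.
        · have h := (hcon.1 i).le
          have hp0 := p.2.1
          have hp1 := p.2.2
          rw [abs_le] at h ⊢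
          simp only [Fintype.card_fin]
          constructor
          · convert (show -(δ * n) ≤ (G.degree i : ℝ) - n * p by nlinarith)
          · convert (show (G.degree i : ℝ) - n * p ≤ δ * n by nlinarith)
        · have h := hcon.2 (i, j) (by simpa using hij)
          push Not at h
          obtain ⟨k, -, hk⟩ := h
          exact ⟨k, hk⟩
    _ ≤ ∑ i : Fin n, μ.real {G | δ * n / 2 ≤
            |(G.degree i : ℝ) - (Fintype.card (Fin n) - 1) * p|} +
          ∑ q ∈ (Finset.univ : Finset (Fin n)).offDiag,
            μ.real {G | ∀ k ∈ Finset.univ \ {q.1, q.2}, ¬ (G.Adj q.1 k ∧ G.Adj q.2 k)} :=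
        (measureReal_union_le _ _).trans (add_le_add (measureReal_iUnion_fintype_le _)
          (measureReal_biUnion_finset_le _ _))
    _ ≤ ∑ i : Fin n, 2 * Real.exp (-(δ ^ 2 / 2) * n) +
          ∑ q ∈ (Finset.univ : Finset (Fin n)).offDiag, (1 - (p : ℝ) ^ 2) ^ (n - 2) := by
        refine add_le_add (Finset.sum_le_sum fun i _ => ?_) (Finset.sum_le_sum fun q hq => ?_)
        · refine (binomialRandom_real_le_abs_degree_sub p i (by positivity)).trans_eq ?_
          congr 2
          simp only [Fintype.card_fin]
          field_simp
        · have hne : q.1 ≠ q.2 := (Finset.mem_offDiag.1 hq).2.2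
          rw [binomialRandom_real_no_common_neighbor p hne _ (by simp) (by simp),
            Finset.card_sdiff_of_subset (Finset.subset_univ _), Finset.card_pair hne]
          simp
    _ ≤ _ := by
        rw [Finset.sum_const, Finset.sum_const, nsmul_eq_mul, nsmul_eq_mul]
        have hp : 0 ≤ 1 - (p : ℝ) ^ 2 := by nlinarith [p.2.1, p.2.2]
        gcongr
        · simp
        · rw [Finset.offDiag_card]
          simp only [Finset.card_univ, Fintype.card_fin]
          calc ((n * n - n : ℕ) : ℝ) ≤ ((n * n : ℕ) : ℝ) := by exact_mod_cast Nat.sub_le _ _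
            _ = (n : ℝ) ^ 2 := by push_cast; ring

theorem almostAll_isTypical (p : I) (hp : 0 < (p : ℝ)) {δ : ℝ} (hδ : 0 < δ) :
    AlmostAll p fun _ G => G.IsTypical p δ := by
  have hexp : Tendsto (fun n : ℕ => (n : ℝ) * (2 * Real.exp (-(δ ^ 2 / 2) * n))) atTop (𝓝 0) := by
    have h := ((Real.tendsto_pow_mul_exp_neg_atTop_nhds_zero 1).comp
      (tendsto_natCast_atTop_atTop.const_mul_atTop
        (by positivity : 0 < δ ^ 2 / 2))).const_mul (4 / δ ^ 2)
    rw [mul_zero] at h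
    refine h.congr fun n => ?_
    simp only [Function.comp_apply, pow_one, neg_mul]
    field_simp
    ring
  have hpow : Tendsto (fun n : ℕ => (n : ℝ) ^ 2 * (1 - (p : ℝ) ^ 2) ^ (n - 2)) atTop (𝓝 0) := by
    have hp1 : (p : ℝ) ≤ 1 := p.2.2
    -- The shift removes the truncated subtraction; then `(n + 2) ^ 2 = n ^ 2 + 4 n + 4` is treated
    -- termwise.
    rw [← tendsto_add_atTop_iff_nat 2]
    have h0 : |1 - (p : ℝ) ^ 2| < 1 := by
      rw [abs_lt]; constructor <;> nlinarith
    have h := (tendsto_pow_const_mul_const_pow_of_abs_lt_one 2 h0).add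
      (((tendsto_pow_const_mul_const_pow_of_abs_lt_one 1 h0).const_mul 4).add
      ((tendsto_pow_const_mul_const_pow_of_abs_lt_one 0 h0).const_mul 4))
    simp only [mul_zero, add_zero] at h
    refine h.congr fun n => ?_
    simp only [Nat.add_sub_cancel]
    push_cast
    ring
  have hbad : Tendsto (fun n : ℕ => (binomialRandom (Fin n) p).real {G | ¬ G.IsTypical p δ})
      atTop (𝓝 0) := by
    have h := hexp.add hpow
    rw [add_zero] at h
    refine tendsto_of_tendsto_of_tendsto_of_le_of_le' tendsto_const_nhds h
      (.of_forall fun _ => measureReal_nonneg) ?_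
    filter_upwards [(tendsto_natCast_atTop_atTop.const_mul_atTop hδ).eventually_ge_atTop
      (2 : ℝ)] with n hn
    exact binomialRandom_real_not_isTypical_le p hδ hn
  have hbad' : Tendsto (fun n : ℕ => 1 - binomialRandom (Fin n) p {G | ¬ G.IsTypical p δ})
      atTop (𝓝 1) := by
    have h := ENNReal.tendsto_ofReal hbad
    simp only [ENNReal.ofReal_zero] at h
    simpa using ENNReal.Tendsto.sub tendsto_const_nhds h (.inl ENNReal.one_ne_top)
  refine tendsto_of_tendsto_of_tendsto_of_le_of_le hbad' tendsto_const_nhds (fun n => ?_)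
    fun n => prob_le_one
  -- Subadditivity suffices here, so measurability of the typical event does not enter.
  rw [tsub_le_iff_right, ← measure_univ (μ := binomialRandom (Fin n) p)]
  refine (measure_mono fun G _ => ?_).trans (measure_union_le _ _)
  exact em _

end SimpleGraph

theorem AlmostAll.mono {p : unitInterval} {P Q : ∀ n : ℕ, SimpleGraph (Fin n) → Prop}
    (hP : AlmostAll p P) (h : ∀ᶠ n in atTop, ∀ G, P n G → Q n G) : AlmostAll p Q := by
  refine tendsto_of_tendsto_of_tendsto_of_le_of_le' hP tendsto_const_nhds ?_
    (.of_forall fun n => MeasureTheory.prob_le_one)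
  filter_upwards [h] with n hn
  exact MeasureTheory.measure_mono (hn ·)

/-! ### Entries and row sums for a typical graph. -/

section Deterministic

variable {V : Type*} [Fintype V] [DecidableEq V] (f : ℕ∞ → ℝ → ℝ → ℝ) (G : SimpleGraph V)

theorem weightedDistanceMatrix_self (i : V) : weightedDistanceMatrix f G i i = 0 := by
  simp [weightedDistanceMatrix]

theorem weightedDistanceMatrix_of_ne {i j : V} (hij : i ≠ j) :
    open Classical in
    weightedDistanceMatrix f G i j = f (G.edist i j) (G.degree i) (G.degree j) := by
  simp [weightedDistanceMatrix, hij]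

open Classical in
/-- Entries of the weighted distance matrix of a typical graph are close to `a` on edges and to `b`
on nonadjacent pairs, if the weights are. -/
theorem abs_weightedDistanceMatrix_sub_le {p δ a b t : ℝ} (hG : G.IsTypical p δ) (ht : 0 ≤ t)
    (h1 : ∀ x y : ℝ, |x - Fintype.card V * p| ≤ δ * Fintype.card V →
      |y - Fintype.card V * p| ≤ δ * Fintype.card V → |f 1 x y - a| ≤ t)
    (h2 : ∀ x y : ℝ, |x - Fintype.card V * p| ≤ δ * Fintype.card V →
      |y - Fintype.card V * p| ≤ δ * Fintype.card V → |f 2 x y - b| ≤ t) (i j : V) :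
    |weightedDistanceMatrix f G i j -
      ((if G.Adj i j then a - b else 0) + b - if i = j then b else 0)| ≤ t := by
  by_cases hij : i = j
  · subst hij
    simpa [weightedDistanceMatrix_self] using ht
  rw [weightedDistanceMatrix_of_ne f G hij]
  by_cases hadj : G.Adj i j
  · rw [SimpleGraph.edist_eq_one_iff_adj.2 hadj]
    simpa [hadj, hij] using h1 _ _ (hG.1 i) (hG.1 j)
  · obtain ⟨k, hi, hj⟩ := hG.2 i j hij
    rw [SimpleGraph.edist_eq_two_of_common_neighbor hij hadj hi hj]
    simpa [hadj, hij] using h2 _ _ (hG.1 i) (hG.1 j)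

/-- The model row sum is `deg a + (n - 1 - deg) b`. The three error terms come from the entries,
from the deviation of the degree, and from the missing diagonal `b`. -/
theorem abs_sum_weightedDistanceMatrix_sub_le {p δ a b t : ℝ} (hG : G.IsTypical p δ) (ht : 0 ≤ t)
    (h1 : ∀ x y : ℝ, |x - Fintype.card V * p| ≤ δ * Fintype.card V →
      |y - Fintype.card V * p| ≤ δ * Fintype.card V → |f 1 x y - a| ≤ t)
    (h2 : ∀ x y : ℝ, |x - Fintype.card V * p| ≤ δ * Fintype.card V →
      |y - Fintype.card V * p| ≤ δ * Fintype.card V → |f 2 x y - b| ≤ t) (i : V) :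
    |∑ j, weightedDistanceMatrix f G i j - Fintype.card V * (p * a + (1 - p) * b)| ≤
      Fintype.card V * t + (|a| + |b|) * (δ * Fintype.card V) + |b| := by
  classical
  have hsum : ∑ j, ((if G.Adj i j then a - b else 0) + b - if i = j then b else 0) =
      G.degree i * (a - b) + Fintype.card V * b - b := by
    rw [Finset.sum_sub_distrib, Finset.sum_add_distrib]
    simp [← G.card_neighborFinset_eq_degree, SimpleGraph.neighborFinset_eq_filter,
      Finset.sum_ite]
    ring
  have hdecomp : ∑ j, weightedDistanceMatrix f G i j - Fintype.card V * (p * a + (1 - p) * b) =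
      ∑ j, (weightedDistanceMatrix f G i j -
        ((if G.Adj i j then a - b else 0) + b - if i = j then b else 0)) +
      (((G.degree i : ℝ) - Fintype.card V * p) * (a - b) - b) := by
    rw [Finset.sum_sub_distrib, hsum]
    ring
  have hentries : |∑ j, (weightedDistanceMatrix f G i j -
      ((if G.Adj i j then a - b else 0) + b - if i = j then b else 0))| ≤ Fintype.card V * t := by
    refine (Finset.abs_sum_le_sum_abs _ _).trans ((Finset.sum_le_sum fun j _ =>
      abs_weightedDistanceMatrix_sub_le f G hG ht h1 h2 i j).trans_eq ?_)
    simp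
  have hdeg : |((G.degree i : ℝ) - Fintype.card V * p) * (a - b)| ≤
      (|a| + |b|) * (δ * Fintype.card V) := by
    have hi := hG.1 i
    rw [abs_mul, mul_comm]
    gcongr
    exact abs_sub a b
  rw [hdecomp]
  calc _ ≤ _ := abs_add_le _ _
    _ ≤ _ := add_le_add hentries (abs_sub _ _)
    _ ≤ _ := by linarith

end Deterministic

/-! ### Asymptotics of the two invariants. -/

theorem Matrix.IsHermitian.abs_sum_sqrt_abs_eigenvalues_sub_le_of_entries
    {V : Type*} [Fintype V] [DecidableEq V] {M : Matrix V V ℝ} (hM : M.IsHermitian)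
    {c r s u v : ℝ} (hr : 0 ≤ r) (hs : 0 ≤ s)
    (hdiag : ∀ i, |M i i - c| ≤ u) (hoff : ∀ i j, i ≠ j → |M i j| ≤ v)
    (h : u ^ 2 + Fintype.card V * v ^ 2 ≤ r ^ 4 * s ^ 2) :
    |∑ i, √|hM.eigenvalues i| - Fintype.card V * √(|c|)| ≤ r * Fintype.card V * √s := by
  refine hM.abs_sum_sqrt_abs_eigenvalues_sub_le hr hs ?_
  have hrow : ∀ i, ∑ j, (M i j - if i = j then c else 0) ^ 2 ≤ u ^ 2 + Fintype.card V * v ^ 2 := by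
    intro i
    calc ∑ j, (M i j - if i = j then c else 0) ^ 2
        ≤ ∑ j, ((if i = j then u ^ 2 else 0) + v ^ 2) := by
          refine Finset.sum_le_sum fun j _ => ?_
          by_cases hij : i = j
          · subst hij
            have := sq_le_sq' (abs_le.1 (hdiag i)).1 (abs_le.1 (hdiag i)).2
            simp only [if_true]
            nlinarith [sq_nonneg v]
          · have := sq_le_sq' (abs_le.1 (hoff i j hij)).1 (abs_le.1 (hoff i j hij)).2
            simpa [hij] using this
      _ = u ^ 2 + Fintype.card V * v ^ 2 := by simp [Finset.sum_add_distrib]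
  calc _ ≤ ∑ _i : V, (r ^ 4 * s ^ 2) := Finset.sum_le_sum fun i _ => (hrow i).trans h
    _ = r ^ 4 * Fintype.card V * s ^ 2 := by simp; ring

/-- If the weights at the mean degree are asymptotic to `A g` at distance `1` and to `B g` at
distance `2`, then for almost all graphs the sum of `√|λ|` over the eigenvalues of a matrix with
diagonal `D_f` and off-diagonal part `± W_f` is `√|g n| (√|p A + (1 - p) B| + o(1)) n ^ (3 / 2)`. -/
theorem almostAllAsymp_sum_sqrt_abs_eigenvalues (p : unitInterval) (hp : 0 < (p : ℝ))
    {f : ℕ∞ → ℝ → ℝ → ℝ} (h1 : StableNearMean (f 1) p) (h2 : StableNearMean (f 2) p)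
    {g : ℕ → ℝ} (hg : ∀ᶠ n in atTop, g n ≠ 0) {A B : ℝ}
    (hA : Tendsto (fun n : ℕ => f 1 (n * p) (n * p) / g n) atTop (𝓝 A))
    (hB : Tendsto (fun n : ℕ => f 2 (n * p) (n * p) / g n) atTop (𝓝 B))
    (M : ∀ n, SimpleGraph (Fin n) → Matrix (Fin n) (Fin n) ℝ) (hM : ∀ n G, (M n G).IsHermitian)
    (hdiag : ∀ n G i, M n G i i = ∑ j, weightedDistanceMatrix f G i j)
    (hoff : ∀ n G i j, i ≠ j → |M n G i j| = |weightedDistanceMatrix f G i j|) :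
    AlmostAllAsymp p (fun n G => ∑ i, √|(hM n G).eigenvalues i|) (fun n => √|g n|)
      (√|p * A + (1 - p) * B|) := by
  classical
  intro ε hε
  -- `K |g n|` will bound the off-diagonal entries; the summand 1 covers the error `τ ≤ 1`.
  set K : ℝ := |A| + |B| + 1
  have hK : 0 < K := by positivity
  -- The row-sum error splits into three parts governed by `τ`, `K δ` and `K / n`, each at most `ρ /
  -- 3`. Squared, the diagonal uses `ρ ^ 2 = ε ^ 4 / 4` of the budget `ε ^ 4`; `n ≥ 2 K ^ 2 / ε ^ 4`
  -- limits the off-diagonal part to `ε ^ 4 / 2`.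
  set ρ : ℝ := ε ^ 2 / 2
  have hρ : 0 < ρ := by positivity
  have hτ : 0 < min 1 (ρ / 3) := by positivity
  set τ : ℝ := min 1 (ρ / 3)
  obtain ⟨δ₁, hδ₁, hf1⟩ := h1.exists_eventually_abs_sub_le hp hg hA hτ
  obtain ⟨δ₂, hδ₂, hf2⟩ := h2.exists_eventually_abs_sub_le hp hg hB hτ
  have hδ : 0 < min (min δ₁ δ₂) (ρ / (3 * K)) := by positivity
  set δ : ℝ := min (min δ₁ δ₂) (ρ / (3 * K))
  refine (SimpleGraph.almostAll_isTypical p hp hδ).mono ?_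
  have hlarge := tendsto_natCast_atTop_atTop (R := ℝ)
  filter_upwards [hf1, hf2, hg, hlarge.eventually_ge_atTop (3 * K / ρ),
    hlarge.eventually_ge_atTop (2 * K ^ 2 / ε ^ 4), hlarge.eventually_gt_atTop 0]
    with n hf1 hf2 hgn hn1 hn2 hn0 G hG
  have hgpos : 0 < |g n| := abs_pos.2 hgn
  have hδ1 : δ * n ≤ δ₁ * n := by
    gcongr; exact (min_le_left _ _).trans (min_le_left _ _)
  have hδ2 : δ * n ≤ δ₂ * n := by
    gcongr; exact (min_le_left _ _).trans (min_le_right _ _)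
  have hδ3 : K * δ ≤ ρ / 3 := by
    have : δ ≤ ρ / (3 * K) := min_le_right _ _
    calc K * δ ≤ K * (ρ / (3 * K)) := by gcongr
      _ = ρ / 3 := by field_simp
  have hn1' : K ≤ ρ / 3 * n := by
    rw [div_le_iff₀ hρ] at hn1; linarith
  have hn2' : 2 * K ^ 2 ≤ ε ^ 4 * n := by
    rw [div_le_iff₀ (by positivity)] at hn2; linarith
  have hf1' : ∀ x y : ℝ, |x - Fintype.card (Fin n) * p| ≤ δ * Fintype.card (Fin n) →
      |y - Fintype.card (Fin n) * p| ≤ δ * Fintype.card (Fin n) →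
      |f 1 x y - A * g n| ≤ τ * |g n| := by
    simp only [Fintype.card_fin]
    exact fun x y hx hy => hf1 x y (hx.trans hδ1) (hy.trans hδ1)
  have hf2' : ∀ x y : ℝ, |x - Fintype.card (Fin n) * p| ≤ δ * Fintype.card (Fin n) →
      |y - Fintype.card (Fin n) * p| ≤ δ * Fintype.card (Fin n) →
      |f 2 x y - B * g n| ≤ τ * |g n| := by
    simp only [Fintype.card_fin]
    exact fun x y hx hy => hf2 x y (hx.trans hδ2) (hy.trans hδ2)
  have hτ1 : τ ≤ 1 := min_le_left _ _
  have hτ2 : τ ≤ ρ / 3 := min_le_right _ _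
  have hD : ∀ i, |M n G i i - n * (p * (A * g n) + (1 - p) * (B * g n))| ≤ ρ * (n * |g n|) := by
    intro i
    rw [hdiag]
    have h := abs_sum_weightedDistanceMatrix_sub_le f G hG (by positivity) hf1' hf2' i
    simp only [Fintype.card_fin, abs_mul] at h
    refine h.trans ?_
    have e1 : τ * (n * |g n|) ≤ ρ / 3 * (n * |g n|) := by gcongr
    have e2 : (|A| + |B|) * (δ * n * |g n|) ≤ K * (δ * n * |g n|) := by
      gcongr; simp [K]
    have e3 : K * δ * (n * |g n|) ≤ ρ / 3 * (n * |g n|) := by gcongr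
    have e4 : |B| * |g n| ≤ K * |g n| := by
      gcongr
      have := abs_nonneg A
      simp only [K]; linarith
    have e5 : K * |g n| ≤ ρ / 3 * n * |g n| := by gcongr
    linarith
  have hW : ∀ i j, i ≠ j → |M n G i j| ≤ K * |g n| := by
    intro i j hij
    rw [hoff n G i j hij]
    have h := abs_weightedDistanceMatrix_sub_le f G hG (by positivity) hf1' hf2' i j
    have hw : |(if G.Adj i j then A * g n - B * g n else 0) + B * g n -
        if i = j then B * g n else 0| ≤ (|A| + |B|) * |g n| := by
      have hA0 : 0 ≤ |A| * |g n| := by positivity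
      have hB0 : 0 ≤ |B| * |g n| := by positivity
      by_cases hadj : G.Adj i j <;> simp [hadj, hij, abs_mul] <;> linarith
    have h3 := abs_sub_abs_le_abs_sub (weightedDistanceMatrix f G i j)
      ((if G.Adj i j then A * g n - B * g n else 0) + B * g n - if i = j then B * g n else 0)
    have h4 : τ * |g n| ≤ 1 * |g n| := by gcongr
    simp only [K]
    linarith
  have key := (hM n G).abs_sum_sqrt_abs_eigenvalues_sub_le_of_entries hε.le
    (by positivity : 0 ≤ n * |g n|) hD hW (by
      have e1 : 2 * K ^ 2 * (n * |g n| ^ 2) ≤ ε ^ 4 * n * (n * |g n| ^ 2) := by gcongr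
      have e2 : 0 ≤ ε ^ 4 * (n * |g n|) ^ 2 := by positivity
      simp only [Fintype.card_fin, ρ]
      linarith)
  have hpow : (n : ℝ) ^ (3 / 2 : ℝ) = n * √n := by
    rw [Real.sqrt_eq_rpow, ← Real.rpow_one_add' hn0.le (by norm_num)]
    norm_num
  have hsc : √|(n : ℝ) * (p * (A * g n) + (1 - p) * (B * g n))| =
      √n * √|g n| * √|p * A + (1 - p) * B| := by
    rw [← Real.sqrt_mul hn0.le, ← Real.sqrt_mul (by positivity)]
    congr 1
    nth_rw 2 [← abs_of_pos hn0]
    rw [← abs_mul, ← abs_mul]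
    congr 1
    ring
  rw [hsc, Real.sqrt_mul hn0.le, Fintype.card_fin] at key
  set S : ℝ := ∑ i, √|(hM n G).eigenvalues i|
  have hQ : 0 < √|g n| * (n * √n) := by positivity
  refine ⟨S / (√|g n| * (n * √n)) - √|p * A + (1 - p) * B|, ?_, ?_⟩
  · have : S / (√|g n| * (n * √n)) - √|p * A + (1 - p) * B| =
        (S - n * (√n * √|g n| * √|p * A + (1 - p) * B|)) / (√|g n| * (n * √n)) := by
      field_simp
    rw [this, abs_div, abs_of_pos hQ, div_le_iff₀ hQ]
    linarith
  · rw [hpow]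
    field_simp
    ring

theorem weightedLaplacian_apply_self {V : Type*} [Fintype V] [DecidableEq V]
    (f : ℕ∞ → ℝ → ℝ → ℝ) (G : SimpleGraph V) (i : V) :
    weightedLaplacian f G i i = ∑ j, weightedDistanceMatrix f G i j := by
  simp [weightedLaplacian, weightedDegreeMatrix, weightedDistanceMatrix_self]

theorem weightedSignlessLaplacian_apply_self {V : Type*} [Fintype V] [DecidableEq V]
    (f : ℕ∞ → ℝ → ℝ → ℝ) (G : SimpleGraph V) (i : V) :
    weightedSignlessLaplacian f G i i = ∑ j, weightedDistanceMatrix f G i j := by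
  simp [weightedSignlessLaplacian, weightedDegreeMatrix, weightedDistanceMatrix_self]

theorem almostAllAsymp_weightedLEL_and_weightedIE (p : unitInterval) (hp : 0 < (p : ℝ))
    {f : ℕ∞ → ℝ → ℝ → ℝ} (hf : ∀ d x y, f d x y = f d y x)
    (h1 : StableNearMean (f 1) p) (h2 : StableNearMean (f 2) p)
    {g : ℕ → ℝ} (hg : ∀ᶠ n in atTop, g n ≠ 0) {A B : ℝ}
    (hA : Tendsto (fun n : ℕ => f 1 (n * p) (n * p) / g n) atTop (𝓝 A))
    (hB : Tendsto (fun n : ℕ => f 2 (n * p) (n * p) / g n) atTop (𝓝 B)) :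
    AlmostAllAsymp p (fun _ G => weightedLEL f hf G) (fun n => √|g n|)
        (√|p * A + (1 - p) * B|) ∧
      AlmostAllAsymp p (fun _ G => weightedIE f hf G) (fun n => √|g n|)
        (√|p * A + (1 - p) * B|) := by
  refine ⟨almostAllAsymp_sum_sqrt_abs_eigenvalues p hp h1 h2 hg hA hB
      (fun _ G => weightedLaplacian f G) (fun _ G => weightedLaplacian_isHermitian hf G)
      (fun _ G i => weightedLaplacian_apply_self f G i) fun _ G i j hij => ?_,
    almostAllAsymp_sum_sqrt_abs_eigenvalues p hp h1 h2 hg hA hB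
      (fun _ G => weightedSignlessLaplacian f G)
      (fun _ G => weightedSignlessLaplacian_isHermitian hf G)
      (fun _ G i => weightedSignlessLaplacian_apply_self f G i) fun _ G i j hij => ?_⟩
  · simp [weightedLaplacian, weightedDegreeMatrix, hij]
  · simp [weightedSignlessLaplacian, weightedDegreeMatrix, hij]

/-- If `|a / b| → ∞`, with `|a / 0| = ∞` for `a ≠ 0` and `|0 / 0| = 0`, then `a` is eventually
nonzero and `b / a → 0`. -/
theorem eventually_ne_zero_and_tendsto_div_of_enorm_div_tendsto_top {a b : ℕ → ℝ}
    (h : Tendsto (fun n => ‖a n‖ₑ / ‖b n‖ₑ) atTop (𝓝 ⊤)) :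
    (∀ᶠ n in atTop, a n ≠ 0) ∧ Tendsto (fun n => b n / a n) atTop (𝓝 0) := by
  have hne : ∀ᶠ n in atTop, a n ≠ 0 := by
    filter_upwards [h.eventually (lt_mem_nhds ENNReal.zero_lt_top)] with n hn h0
    simp [h0] at hn
  refine ⟨hne, ?_⟩
  rw [tendsto_zero_iff_enorm_tendsto_zero]
  have hinv := tendsto_inv_iff.2 h
  rw [ENNReal.inv_top] at hinv
  refine hinv.congr' ?_
  filter_upwards [hne] with n hn
  rw [ENNReal.inv_div (.inl enorm_ne_top) (.inr (by simpa using hn)), div_eq_mul_inv (b n),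
    enorm_mul, enorm_inv hn, div_eq_mul_inv]

theorem theorem1p8 (p : unitInterval) (hp0 : 0 < (p : ℝ)) (hp1 : (p : ℝ) < 1)
    (f : ℕ∞ → ℝ → ℝ → ℝ) (hf : ∀ d x y, f d x y = f d y x)
    (h1 : StableNearMean (f 1) p) (h2 : StableNearMean (f 2) p) :
    -- The quotient is taken in `[0, ∞]`, where `a / 0 = ∞` for `a ≠ 0` and `0 / 0 = 0`.
    (Tendsto (fun n : ℕ => ‖f 1 (n * p) (n * p)‖ₑ / ‖f 2 (n * p) (n * p)‖ₑ) atTop (𝓝 ⊤) →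
      AlmostAllAsymp p (fun _ G => weightedLEL f hf G)
        (fun n => √|f 1 (n * p) (n * p)|) (√(p : ℝ)) ∧
      AlmostAllAsymp p (fun _ G => weightedIE f hf G)
        (fun n => √|f 1 (n * p) (n * p)|) (√(p : ℝ))) ∧
    (∀ C : ℝ, (∀ᶠ n : ℕ in atTop, f 2 (n * p) (n * p) ≠ 0) →
      Tendsto (fun n : ℕ => f 1 (n * p) (n * p) / f 2 (n * p) (n * p)) atTop (𝓝 C) →
      AlmostAllAsymp p (fun _ G => weightedLEL f hf G)
        (fun n => √|f 2 (n * p) (n * p)|) (√|1 + (C - 1) * (p : ℝ)|) ∧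
      AlmostAllAsymp p (fun _ G => weightedIE f hf G)
        (fun n => √|f 2 (n * p) (n * p)|) (√|1 + (C - 1) * (p : ℝ)|)) := by
  refine ⟨fun h => ?_, fun C hne hC => ?_⟩
  -- Normalise by the weight at distance 1: `A = 1`, `B = 0`.
  · obtain ⟨hne, h0⟩ := eventually_ne_zero_and_tendsto_div_of_enorm_div_tendsto_top h
    have hone : Tendsto (fun n : ℕ => f 1 (n * p) (n * p) / f 1 (n * p) (n * p)) atTop (𝓝 1) :=
      tendsto_const_nhds.congr' (hne.mono fun n hn => (div_self hn).symm)
    have := almostAllAsymp_weightedLEL_and_weightedIE p hp0 hf h1 h2 hne hone h0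
    rwa [mul_one, mul_zero, add_zero, abs_of_pos hp0] at this
  -- Normalise by the weight at distance 2: `A = C`, `B = 1`.
  · have hone : Tendsto (fun n : ℕ => f 2 (n * p) (n * p) / f 2 (n * p) (n * p)) atTop (𝓝 1) :=
      tendsto_const_nhds.congr' (hne.mono fun n hn => (div_self hn).symm)
    have := almostAllAsymp_weightedLEL_and_weightedIE p hp0 hf h1 h2 hne hC hone
    rwa [show (p : ℝ) * C + (1 - p) * 1 = 1 + (C - 1) * p by ring] at this
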